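/- Consider a $K$-armed Bayesian Gaussian bandit with known reward variances $\sigma_i^2\ge 0$ and known prior means $\mu_{0,i}\in\mathbb R$ and prior variances $\sigma_{0,i}^2\ge 0$, $i\in[K]$. The mean rewards $\mu_i\sim\mathcal N(\mu_{0,i},\sigma_{0,i}^2)$ are drawn independently over the arms. For $n$ rounds an agent pulls in round $t$ an arm $A_t$ and observes a reward $x_t$, which, given $\boldsymbol\mu$, the history $H_t=(A_1,x_1,\dots,A_{t-1},x_{t-1})$ and $A_t$, has law $\mathcal N(\mu_{A_t},\sigma_{A_t}^2)$. The agent is Gaussian Thompson sampling: in round $t$, given $H_t$ and independently of $\boldsymbol\mu$, it draws independent $\tilde\mu_{t,i}\sim\mathcal N(\hat\mu_{t,i},\sigma_{t,i}^2)$, $i\in[K]$, and pulls $A_t=\arg\max_i\tilde\mu_{t,i}$. Here $$\sigma_{t,i}^2=\frac{1}{\sigma_{0,i}^{-2}+N_t(i)\,\sigma_i^{-2}},\qquad \hat\mu_{t,i}=\sigma_{t,i}^2\Big(\frac{\mu_{0,i}}{\sigma_{0,i}^2}+\frac{N_t(i)\,\bar x_{t,i}}{\sigma_i^2}\Big),$$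 where $N_t(i)=\sum_{s<t}\mathbf 1\{A_s=i\}$ and $\bar x_{t,i}=N_t(i)^{-1}\sum_{s<t}\mathbf 1\{A_s=i\}x_s$ (with $\bar x_{t,i}=0$ if $N_t(i)=0$). If $\sigma_{0,i}^2=0$, then $(\hat\mu_{t,i},\sigma_{t,i}^2)=(\mu_{0,i},0)$; if $\sigma_i^2=0<\sigma_{0,i}^2$, then $(\hat\mu_{t,i},\sigma_{t,i}^2)$ is $(\mu_{0,i},\sigma_{0,i}^2)$ when $N_t(i)=0$ and $(\bar x_{t,i},0)$ otherwise. Ties in $\arg\max$ are broken by an arbitrary fixed measurable rule. Let $A^*=\arg\max_i\mu_i$. Then for every $\delta>0$ the regret $\sum_{t=1}^n(\mu_{A^*}-\mu_{A_t})$ is integrable and $$\mathbb E\Big[\sum_{t=1}^n(\mu_{A^*}-\mu_{A_t})\Big]\le \sqrt{2n}\,\sqrt{\sum_{i=1}^K\sigma_i^2\log\Big(1+\frac{n\sigma_{0,i}^2}{\sigma_i^2}\Big)\log\frac1\delta}+\sqrt{2n\sum_{i=1}^K\sigma_{0,i}^2\log\frac1\delta}+\sum_{i=1}^K\sqrt{\frac{2\sigma_{0,i}^2}{\pi}}\;n\delta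 .$$ Moreover, the right-hand side is nondecreasing in every reward variance $\sigma_i^2$ and in every prior variance $\sigma_{0,i}^2$. (If $\delta>1$, the square root of a negative number is read as $0$; if $\sigma_i^2=0$, then $\sigma_i^2\log(1+n\sigma_{0,i}^2/\sigma_i^2)$ is read as its limit $0$.) -/

import Mathlib

open MeasureTheory ProbabilityTheory
open scoped NNReal

noncomputable section

namespace GaussianBandit

/-! ### Gaussian kernels -/

lemma gaussianReal_eq_map_std (m : ℝ) (v : ℝ≥0) :
    gaussianReal m v = (gaussianReal 0 1).map (fun z => m + √(v : ℝ) * z) := by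
  have h : (fun z : ℝ => m + √(v : ℝ) * z) = (fun y => m + y) ∘ (fun z => √(v : ℝ) * z) := rfl
  rw [h, ← Measure.map_map (by fun_prop) (by fun_prop), gaussianReal_map_const_mul,
    gaussianReal_map_const_add]
  congr 1
  · simp
  · ext
    simp [Real.sq_sqrt]

lemma measurable_gaussianReal_comp {T : Type*} [MeasurableSpace T] {m : T → ℝ} {v : T → ℝ≥0}
    (hm : Measurable m) (hv : Measurable v) :
    Measurable (fun x => gaussianReal (m x) (v x)) := by
  have hf : Measurable (fun p : T × ℝ => m p.1 + √(v p.1 : ℝ) * p.2) := by fun_prop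
  have h : (fun x => gaussianReal (m x) (v x)) =
      fun x => ((Kernel.id ×ₖ Kernel.const T (gaussianReal 0 1)).map
        (fun p : T × ℝ => m p.1 + √(v p.1 : ℝ) * p.2)) x := by
    funext x
    rw [Kernel.map_apply _ hf, Kernel.prod_apply, Kernel.id_apply, Kernel.const_apply,
      Measure.dirac_prod, Measure.map_map hf (by fun_prop), gaussianReal_eq_map_std]
    rfl
  rw [h]
  exact Kernel.measurable _

lemma measurable_pi_gaussianReal {T ι : Type*} [MeasurableSpace T] [Fintype ι]
    {m : T → ι → ℝ} {v : T → ι → ℝ≥0} (hm : Measurable m) (hv : Measurable v) :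
    Measurable (fun x => Measure.pi fun i => gaussianReal (m x i) (v x i)) := by
  have hf : Measurable
      (fun p : T × (ι → ℝ) => fun i => m p.1 i + √(v p.1 i : ℝ) * p.2 i) := by fun_prop
  have h : (fun x => Measure.pi fun i => gaussianReal (m x i) (v x i)) =
      fun x => ((Kernel.id ×ₖ Kernel.const T (Measure.pi fun _ : ι => gaussianReal 0 1)).map
        (fun p : T × (ι → ℝ) => fun i => m p.1 i + √(v p.1 i : ℝ) * p.2 i)) x := by
    funext x
    rw [Kernel.map_apply _ hf, Kernel.prod_apply, Kernel.id_apply, Kernel.const_apply,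
      Measure.dirac_prod, Measure.map_map hf (by fun_prop)]
    simp_rw [fun i => gaussianReal_eq_map_std (m x i) (v x i)]
    rw [← Measure.pi_map_pi (fun i => by fun_prop)]
    rfl
  rw [h]
  exact Kernel.measurable _

/-! ### Histories and posteriors

All variance parameters are variances (not standard deviations): `v i` is the reward variance of
arm `i`, and `m₀ i`, `v₀ i` are the prior mean and the prior variance of its mean reward. -/

/-- The history of `t` rounds: the pulled arm and the observed reward of each of them. -/
abbrev History (K t : ℕ) : Type := Fin t → Fin K × ℝ

variable {K t : ℕ}

/-- Number of pulls of arm `i`. -/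
def pullCount (h : History K t) (i : Fin K) : ℕ :=
  ∑ s, if (h s).1 = i then 1 else 0

/-- Empirical mean reward of arm `i` (`0` if the arm has not been pulled). -/
def empMean (h : History K t) (i : Fin K) : ℝ :=
  (∑ s, if (h s).1 = i then (h s).2 else 0) / (pullCount h i : ℝ)

/-- Posterior variance of arm `i`. For positive variances this is `1 / (1/v₀ + N/v)`. A zero prior
variance means that the mean is known; a zero reward variance means that one reward reveals it. -/
def postVar (v₀ v : Fin K → ℝ≥0) (h : History K t) (i : Fin K) : ℝ≥0 :=
  if v₀ i = 0 then 0
  else if v i = 0 then (if pullCount h i = 0 then v₀ i else 0)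
  else 1 / (1 / v₀ i + (pullCount h i : ℝ≥0) / v i)

/-- Posterior mean of arm `i`, with the same treatment of zero variances. -/
def postMean (m₀ : Fin K → ℝ) (v₀ v : Fin K → ℝ≥0) (h : History K t) (i : Fin K) : ℝ :=
  if v₀ i = 0 then m₀ i
  else if v i = 0 then (if pullCount h i = 0 then m₀ i else empMean h i)
  else (postVar v₀ v h i : ℝ) *
    (m₀ i / (v₀ i : ℝ) + (pullCount h i : ℝ) * empMean h i / (v i : ℝ))

lemma measurable_pullCount (i : Fin K) : Measurable (fun h : History K t => pullCount h i) := by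
  unfold pullCount
  refine Finset.measurable_sum _ fun s _ => ?_
  exact Measurable.ite
    ((measurableSet_singleton i).preimage (measurable_fst.comp (measurable_pi_apply s)))
    measurable_const measurable_const

lemma measurable_empMean (i : Fin K) : Measurable (fun h : History K t => empMean h i) := by
  unfold empMean
  refine Measurable.div (Finset.measurable_sum _ fun s _ => ?_)
    (measurable_from_nat.comp (measurable_pullCount i))
  exact Measurable.ite
    ((measurableSet_singleton i).preimage (measurable_fst.comp (measurable_pi_apply s)))
    (measurable_snd.comp (measurable_pi_apply s)) measurable_const

lemma measurable_postVar (v₀ v : Fin K → ℝ≥0) :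
    Measurable (fun h : History K t => postVar v₀ v h) := by
  refine measurable_pi_lambda _ fun i => ?_
  exact (measurable_from_nat (f := fun N : ℕ => if v₀ i = 0 then (0 : ℝ≥0)
    else if v i = 0 then (if N = 0 then v₀ i else 0)
    else 1 / (1 / v₀ i + (N : ℝ≥0) / v i))).comp (measurable_pullCount i)

lemma measurable_postMean (m₀ : Fin K → ℝ) (v₀ v : Fin K → ℝ≥0) :
    Measurable (fun h : History K t => postMean m₀ v₀ v h) := by
  refine measurable_pi_lambda _ fun i => ?_
  have hN : Measurable (fun h : History K t => (pullCount h i : ℝ)) :=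
    measurable_from_nat.comp (measurable_pullCount i)
  have hV : Measurable (fun h : History K t => (postVar v₀ v h i : ℝ)) :=
    ((measurable_pi_apply i).comp (measurable_postVar v₀ v)).coe_nnreal_real
  have hE : Measurable (fun h : History K t => empMean h i) := measurable_empMean i
  unfold postMean
  split_ifs with h1 h2
  · exact measurable_const
  · exact Measurable.ite ((measurableSet_singleton 0).preimage (measurable_pullCount i))
      measurable_const hE
  · exact hV.mul (((hN.mul hE).div_const _).const_add _)

/-- The posterior of the vector of mean rewards given the history: independent coordinates, the
`i`-th one being Gaussian with mean `postMean` and variance `postVar`. -/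
def posterior (t : ℕ) (m₀ : Fin K → ℝ) (v₀ v : Fin K → ℝ≥0) :
    Kernel (History K t) (Fin K → ℝ) where
  toFun h := Measure.pi fun i => gaussianReal (postMean m₀ v₀ v h i) (postVar v₀ v h i)
  measurable' :=
    measurable_pi_gaussianReal (measurable_postMean m₀ v₀ v) (measurable_postVar v₀ v)

/-- The law of a posterior sample, as a function of the mean reward vector and the history; it does
not depend on the former. -/
def sampleLaw (t : ℕ) (m₀ : Fin K → ℝ) (v₀ v : Fin K → ℝ≥0) :
    Kernel ((Fin K → ℝ) × History K t) (Fin K → ℝ) :=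
  (posterior t m₀ v₀ v).comap Prod.snd measurable_snd

/-- The law `N(θ i, v i)` of the reward of the pulled arm `i`, as a function of the mean reward
vector `θ`, the history and the pulled arm. -/
def rewardLaw (t : ℕ) (v : Fin K → ℝ≥0) :
    Kernel (((Fin K → ℝ) × History K t) × Fin K) ℝ where
  toFun p := gaussianReal (p.1.1 p.2) (v p.2)
  measurable' := by
    refine measurable_gaussianReal_comp ?_ ?_
    · exact measurable_from_prod_countable_left fun i =>
        (measurable_pi_apply i).comp measurable_fst
    · exact (measurable_of_countable v).comp measurable_snd

/-! ### Gaussian Thompson sampling -/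

/-- A rule that selects a maximiser of each vector, with measurable tie breaking. -/
structure IsArgmaxRule (argmax : (Fin K → ℝ) → Fin K) : Prop where
  measurable : Measurable argmax
  le : ∀ (x : Fin K → ℝ) (i : Fin K), x i ≤ x (argmax x)

variable {Ω : Type*}

/-- The history before round `t` (rounds are numbered from `0`). -/
def history (A : ℕ → Ω → Fin K) (X : ℕ → Ω → ℝ) (t : ℕ) (ω : Ω) : History K t :=
  fun s => (A s ω, X s ω)

/-- `n` rounds of Gaussian Thompson sampling in a Bayesian Gaussian bandit. The random variables
are the mean reward vector `μ`, the posterior samples `μs t`, the pulled arms `A t` and the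
observed rewards `X t` of the pulled arms. -/
structure IsGaussianTS [MeasurableSpace Ω] (P : Measure Ω) (n : ℕ)
    (m₀ : Fin K → ℝ) (v₀ v : Fin K → ℝ≥0) (argmax : (Fin K → ℝ) → Fin K)
    (μ : Ω → Fin K → ℝ) (μs : ℕ → Ω → Fin K → ℝ) (A : ℕ → Ω → Fin K) (X : ℕ → Ω → ℝ) :
    Prop where
  /-- The instance is drawn from the prior. -/
  prior : HasLaw μ (Measure.pi fun i => gaussianReal (m₀ i) (v₀ i)) P
  /-- Given the instance and the history, the sample is drawn from the algorithm's posterior, which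
  depends on the history only. -/
  sample : ∀ t < n, HasCondDistrib (μs t) (fun ω => (μ ω, history A X t ω))
    (sampleLaw t m₀ v₀ v) P
  /-- The pulled arm maximises the sampled mean reward. -/
  pull : ∀ t < n, ∀ᵐ ω ∂P, A t ω = argmax (μs t ω)
  /-- Given the instance, the history and the pulled arm, the reward is Gaussian with the mean and
  the variance of that arm. -/
  reward : ∀ t < n, HasCondDistrib (X t) (fun ω => ((μ ω, history A X t ω), A t ω))
    (rewardLaw t v) P

/-- Realized `n`-round regret `∑ t, (μ_{A*} - μ_{A t})`, where `A* = argmax μ`. -/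
def regret (n : ℕ) (argmax : (Fin K → ℝ) → Fin K) (μ : Ω → Fin K → ℝ) (A : ℕ → Ω → Fin K)
    (ω : Ω) : ℝ :=
  ∑ t ∈ Finset.range n, (μ ω (argmax (μ ω)) - μ ω (A t ω))

/-- The regret bound as a function of the horizon, the confidence parameter, the prior variances
and the reward variances. The square root of a negative number is `0` here, and so is
`v i * log (1 + n * v₀ i / v i)` for `v i = 0`, its limit. -/
def regretBound (n : ℕ) (δ : ℝ) (v₀ v : Fin K → ℝ≥0) : ℝ :=
  √(2 * n) * √(∑ i, (v i : ℝ) * Real.log (1 + n * (v₀ i : ℝ) / (v i : ℝ)) * Real.log (1 / δ))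
    + √(2 * n * ∑ i, (v₀ i : ℝ) * Real.log (1 / δ))
    + ∑ i, √(2 * (v₀ i : ℝ) / Real.pi) * (n * δ)

end GaussianBandit

end

/-! Given the history, the mean vector and the posterior sample are independent with the same law,
and the same rule `argmax` selects `A*` from the one and `A_t` from the other. So any function of
the history and the arm, such as the posterior mean of the arm, has equal conditional expectations
at `A*` and `A_t`. The conditional regret of a round is therefore `E[θ (argmax θ) - m (argmax θ)]`
for a single posterior draw `θ` with mean `m`. By an upper confidence bound it is at most `c` times
the expected posterior deviation of the pulled arm, plus the sum over the arms of the expected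
excess of `θ i` over `m i + c * √(s i)`, where `s` is the posterior variance. A Gaussian tail
integral bounds each excess by `√(s i) * exp (-c²/2) / √(2π)`, and `c = √(2 log (1/δ))` turns the
exponential into `δ` if `δ ≤ 1` (`integral_prod_gap_le`, `IsGaussianTS.integral_gap_le`).

The widths are summed on each path. By Cauchy–Schwarz it suffices to sum the posterior variances of
the pulled arms. For each arm the first pull costs at most the prior variance, and later ones are
dominated by increments of a logarithm (`sum_countVar_le`).

That the algorithm's posterior is the true conditional law is proved by induction on the rounds
(`IsGaussianTS.lintegral_posterior`). The induction step is Gaussian conjugacy for one observation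
(`compProd_obsKernel_eq_map_swap`). -/

noncomputable section

namespace GaussianBandit

/-! ### Gaussian conjugacy -/

section Conjugacy

variable {ι : Type*} [Fintype ι]

lemma integral_cexp_pi_gaussianReal (m : ι → ℝ) (s : ι → ℝ≥0) (c : ι → ℝ) :
    ∫ θ, Complex.exp (((∑ i, c i * θ i : ℝ) : ℂ) * Complex.I)
        ∂(Measure.pi fun i => gaussianReal (m i) (s i)) =
      Complex.exp (∑ i, ((c i : ℂ) * m i * Complex.I - s i * (c i : ℂ) ^ 2 / 2)) := by
  have h : ∀ θ : ι → ℝ, Complex.exp (((∑ i, c i * θ i : ℝ) : ℂ) * Complex.I) =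
      ∏ i, Complex.exp ((c i : ℂ) * (θ i : ℂ) * Complex.I) := by
    intro θ
    rw [← Complex.exp_sum]
    push_cast
    rw [Finset.sum_mul]
  simp_rw [h]
  rw [integral_fintype_prod_eq_prod (fun i (y : ℝ) => Complex.exp ((c i : ℂ) * y * Complex.I)),
    Complex.exp_sum]
  refine Finset.prod_congr rfl fun i _ => ?_
  rw [← charFun_apply_real, charFun_gaussianReal]

lemma integrable_cexp_mul_I {T : Type*} [MeasurableSpace T] {ρ : Measure T} [IsFiniteMeasure ρ]
    {g : T → ℝ} (hg : Measurable g) :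
    Integrable (fun x => Complex.exp ((g x : ℂ) * Complex.I)) ρ := by
  refine Integrable.of_bound (C := 1) (by fun_prop) (ae_of_all _ fun x => ?_)
  rw [Complex.norm_exp_ofReal_mul_I]

variable [DecidableEq ι]

/-- The posterior mean vector after observing the value `x` with law `N(θ a, v)`. -/
def conjMean (m : ι → ℝ) (s : ι → ℝ≥0) (v : ℝ≥0) (a : ι) (x : ℝ) : ι → ℝ :=
  Function.update m a (m a + s a / (s a + v) * (x - m a))

/-- The posterior variance vector after one observation with law `N(θ a, v)`. -/
def conjVar (s : ι → ℝ≥0) (v : ℝ≥0) (a : ι) : ι → ℝ≥0 :=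
  Function.update s a (s a * v / (s a + v))

/-- The law of `x` with law `N(θ a, v)` given `θ`. -/
def obsKernel (v : ℝ≥0) (a : ι) : Kernel (ι → ℝ) ℝ where
  toFun θ := gaussianReal (θ a) v
  measurable' := measurable_gaussianReal_comp (measurable_pi_apply a) measurable_const

/-- The posterior law of `θ` given the observation. -/
def conjKernel (m : ι → ℝ) (s : ι → ℝ≥0) (v : ℝ≥0) (a : ι) : Kernel ℝ (ι → ℝ) where
  toFun x := Measure.pi fun i => gaussianReal (conjMean m s v a x i) (conjVar s v a i)
  measurable' := by
    refine measurable_pi_gaussianReal (m := conjMean m s v a) (v := fun _ => conjVar s v a)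
      ?_ measurable_const
    refine measurable_pi_lambda _ fun i => ?_
    by_cases h : i = a
    · subst h
      simp only [conjMean, Function.update_self]
      fun_prop
    · simp only [conjMean, Function.update_of_ne h]
      fun_prop

instance (v : ℝ≥0) (a : ι) : IsMarkovKernel (obsKernel v a) :=
  ⟨fun θ => by change IsProbabilityMeasure (gaussianReal _ _); infer_instance⟩

instance (m : ι → ℝ) (s : ι → ℝ≥0) (v : ℝ≥0) (a : ι) : IsMarkovKernel (conjKernel m s v a) :=
  ⟨fun x => by
    change IsProbabilityMeasure (Measure.pi fun i => gaussianReal _ _); infer_instance⟩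

/-- Bayes' rule as two disintegrations of one joint Gaussian law: prior then observation, or
predictive law then posterior. Comparing characteristic functions instead of densities covers
degenerate variances as well. -/
theorem compProd_obsKernel_eq_map_swap (m : ι → ℝ) (s : ι → ℝ≥0) (v : ℝ≥0) (a : ι) :
    (Measure.pi fun i => gaussianReal (m i) (s i)) ⊗ₘ obsKernel v a =
      (gaussianReal (m a) (s a + v) ⊗ₘ conjKernel m s v a).map Prod.swap := by
  refine Measure.ext_of_charFunDual (funext fun L => ?_)
  obtain ⟨c, b, hL⟩ : ∃ (c : ι → ℝ) (b : ℝ), ∀ θ x, L (θ, x) = ∑ i, c i * θ i + b * x := by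
    refine ⟨fun i => L (Pi.single i 1, 0), L (0, 1), fun θ x => ?_⟩
    have h1 : ((θ, x) : (ι → ℝ) × ℝ) =
        ∑ i, θ i • ((Pi.single i 1, 0) : (ι → ℝ) × ℝ) + x • (0, 1) := by
      refine Prod.ext ?_ ?_
      · ext j
        simp [Prod.fst_sum, Finset.sum_apply, Pi.single_apply]
      · simp [Prod.snd_sum]
    rw [h1, map_add, map_sum]
    simp only [map_smul, smul_eq_mul]
    simp only [mul_comm]
  have hLm : Measurable fun p : (ι → ℝ) × ℝ => ∑ i, c i * p.1 i + b * p.2 := by fun_prop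
  rw [charFunDual_apply, charFunDual_apply, integral_map (by fun_prop) (by fun_prop)]
  simp only [hL, Prod.swap]
  have hLs : Measurable fun p : ℝ × (ι → ℝ) => ∑ i, c i * p.2 i + b * p.1 := by fun_prop
  rw [Measure.integral_compProd (integrable_cexp_mul_I hLm),
    Measure.integral_compProd (integrable_cexp_mul_I hLs)]
  have hexp : ∀ y x : ℝ, Complex.exp (((y + b * x : ℝ) : ℂ) * Complex.I) =
      Complex.exp ((y : ℂ) * Complex.I) * Complex.exp (b * x * Complex.I) := by
    intro y x
    rw [← Complex.exp_add]
    push_cast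
    ring_nf
  set k : ℝ := s a / (s a + v) with hk
  -- The defining relation of the gain `k`. It survives `s a = v = 0`, where the division gives `k =
  -- 0`.
  have hkv : ((s a : ℝ) + v) * k = s a := by
    rw [hk]
    by_cases h : (s a : ℝ) + v = 0
    · have : (s a : ℝ) = 0 := le_antisymm (by linarith [v.2, h.le]) (s a).2
      rw [h, this]; simp
    · field_simp
  have hlhs : ∀ θ : ι → ℝ, ∫ x, Complex.exp (((∑ i, c i * θ i + b * x : ℝ) : ℂ) * Complex.I)
      ∂(obsKernel v a θ) =
      Complex.exp (((∑ i, (c i + if i = a then b else 0) * θ i : ℝ) : ℂ) * Complex.I) *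
        Complex.exp (- (v * (b : ℂ) ^ 2 / 2)) := by
    intro θ
    simp_rw [hexp]
    rw [integral_const_mul]
    change _ * ∫ x, _ ∂(gaussianReal (θ a) v) = _
    rw [← charFun_apply_real, charFun_gaussianReal, ← Complex.exp_add, ← Complex.exp_add]
    congr 1
    simp only [add_mul, Finset.sum_add_distrib, ite_mul, zero_mul, Finset.sum_ite_eq',
      Finset.mem_univ, if_true]
    push_cast
    ring
  have hm' : ∀ x i, conjMean m s v a x i = m i + if i = a then k * (x - m a) else 0 := by
    intro x i
    by_cases h : i = a
    · subst h; simp [conjMean, hk]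
    · simp [conjMean, h]
  have hs' : ∀ i, (conjVar s v a i : ℝ) = s i - if i = a then s a * k else 0 := by
    intro i
    by_cases h : i = a
    · subst h
      simp only [conjVar, Function.update_self, if_true]
      push_cast
      by_cases h : (s i : ℝ) + v = 0
      · have : (s i : ℝ) = 0 := le_antisymm (by linarith [v.2, h.le]) (s i).2
        rw [h, this]; simp
      · rw [hk]; field_simp; ring
    · simp [conjVar, h]
  have hrhs : ∀ x : ℝ, ∫ θ, Complex.exp (((∑ i, c i * θ i + b * x : ℝ) : ℂ) * Complex.I)
      ∂(conjKernel m s v a x) =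
      Complex.exp ((((b + c a * k : ℝ) : ℂ)) * x * Complex.I) *
        Complex.exp (∑ i, ((c i : ℂ) * m i * Complex.I - s i * (c i : ℂ) ^ 2 / 2)
          - c a * k * m a * Complex.I + s a * k * (c a : ℂ) ^ 2 / 2) := by
    intro x
    simp_rw [hexp]
    rw [integral_mul_const]
    change (∫ θ, _ ∂(Measure.pi fun i =>
      gaussianReal (conjMean m s v a x i) (conjVar s v a i))) * _ = _
    rw [integral_cexp_pi_gaussianReal, ← Complex.exp_add, ← Complex.exp_add]
    congr 1
    have : ∀ i, ((c i : ℂ) * (conjMean m s v a x i : ℝ) * Complex.I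
        - ((conjVar s v a i : ℝ) : ℂ) * (c i : ℂ) ^ 2 / 2) =
        ((c i : ℂ) * m i * Complex.I - s i * (c i : ℂ) ^ 2 / 2) +
        if i = a then (c a : ℂ) * k * (x - m a) * Complex.I + s a * k * (c a : ℂ) ^ 2 / 2
          else 0 := by
      intro i
      rw [hm', hs']
      by_cases h : i = a
      · subst h; simp only [if_true]; push_cast; ring
      · simp only [if_neg h]; push_cast; ring
    rw [Finset.sum_congr rfl fun i _ => this i, Finset.sum_add_distrib]
    simp only [Finset.sum_ite_eq', Finset.mem_univ, if_true]
    push_cast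
    ring
  simp_rw [hlhs, hrhs]
  rw [integral_mul_const, integral_mul_const, integral_cexp_pi_gaussianReal,
    ← charFun_apply_real, charFun_gaussianReal, ← Complex.exp_add, ← Complex.exp_add]
  congr 1
  have : ∀ i, (((c i + if i = a then b else 0 : ℝ) : ℂ) * m i * Complex.I
      - s i * ((c i + if i = a then b else 0 : ℝ) : ℂ) ^ 2 / 2) =
      ((c i : ℂ) * m i * Complex.I - s i * (c i : ℂ) ^ 2 / 2) +
      if i = a then (b : ℂ) * m a * Complex.I - s a * (c a * b + b ^ 2 / 2) else 0 := by
    intro i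
    by_cases h : i = a
    · subst h; simp only [if_true]; push_cast; ring
    · simp only [if_neg h]; push_cast; ring
  rw [Finset.sum_congr rfl fun i _ => this i, Finset.sum_add_distrib]
  rw [Finset.sum_ite_eq' Finset.univ a, if_pos (Finset.mem_univ a)]
  have hkc : ((s a : ℝ) : ℂ) = (((s a : ℝ) : ℂ) + (v : ℝ)) * k := by
    rw [← Complex.ofReal_add, ← Complex.ofReal_mul, hkv]
  push_cast
  -- The exponents differ only in the cross term `c a * b` and in the term `c a ^ 2 * k`, each time
  -- by a multiple of `s a = (s a + v) * k`.
  linear_combination (-(c a : ℂ) * b + (c a : ℂ) ^ 2 * k * (-1 / 2)) * hkc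

theorem lintegral_obs_eq_lintegral_conj (m : ι → ℝ) (s : ι → ℝ≥0) (v : ℝ≥0) (a : ι)
    {f : (ι → ℝ) × ℝ → ENNReal} (hf : Measurable f) :
    ∫⁻ θ, ∫⁻ x, f (θ, x) ∂(gaussianReal (θ a) v) ∂(Measure.pi fun i => gaussianReal (m i) (s i)) =
      ∫⁻ x, ∫⁻ θ, f (θ, x) ∂(Measure.pi fun i =>
        gaussianReal (conjMean m s v a x i) (conjVar s v a i)) ∂(gaussianReal (m a) (s a + v)) := by
  have h := congrArg (fun ρ => ∫⁻ p, f p ∂ρ) (compProd_obsKernel_eq_map_swap m s v a)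
  rw [lintegral_map hf measurable_swap, Measure.lintegral_compProd hf,
    Measure.lintegral_compProd (f := fun p : ℝ × (ι → ℝ) => f p.swap)
      (hf.comp measurable_swap)] at h
  exact h

end Conjugacy

section

/-! ### One round of posterior updating -/

variable {K t : ℕ}

/-- The history `h` extended by one round. -/
def appendRound (h : History K t) (p : Fin K × ℝ) : History K (t + 1) :=
  Fin.snoc (α := fun _ => Fin K × ℝ) h p

lemma measurable_appendRound :
    Measurable fun p : History K t × (Fin K × ℝ) => appendRound p.1 p.2 := by
  refine measurable_pi_lambda _ fun s => ?_
  refine Fin.lastCases ?_ (fun s => ?_) s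
  · simp only [appendRound, Fin.snoc_last]
    exact measurable_snd
  · simp only [appendRound, Fin.snoc_castSucc]
    exact (measurable_pi_apply s).comp measurable_fst

lemma _root_.Measurable.appendRound {T : Type*} [MeasurableSpace T] {g : T → History K t}
    {p : T → Fin K × ℝ} (hg : Measurable g) (hp : Measurable p) :
    Measurable fun x => appendRound (g x) (p x) :=
  measurable_appendRound.comp (hg.prodMk hp)

lemma history_succ {Ω : Type*} (A : ℕ → Ω → Fin K) (X : ℕ → Ω → ℝ) (t : ℕ) (ω : Ω) :
    history A X (t + 1) ω = appendRound (history A X t ω) (A t ω, X t ω) := by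
  funext s
  refine Fin.lastCases ?_ (fun s => ?_) s
  · simp [appendRound, history]
  · simp [appendRound, history]

lemma pullCount_appendRound (h : History K t) (a : Fin K) (x : ℝ) (i : Fin K) :
    pullCount (appendRound h (a, x)) i = pullCount h i + if a = i then 1 else 0 := by
  simp [pullCount, appendRound, Fin.sum_univ_castSucc]

/-- Total reward of arm `i`. -/
def rewardSum (h : History K t) (i : Fin K) : ℝ :=
  ∑ s, if (h s).1 = i then (h s).2 else 0

lemma rewardSum_appendRound (h : History K t) (a : Fin K) (x : ℝ) (i : Fin K) :
    rewardSum (appendRound h (a, x)) i = rewardSum h i + if a = i then x else 0 := by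
  simp [rewardSum, appendRound, Fin.sum_univ_castSucc]

lemma empMean_eq (h : History K t) (i : Fin K) :
    empMean h i = rewardSum h i / pullCount h i := rfl

lemma rewardSum_eq_zero (h : History K t) (i : Fin K) (hN : pullCount h i = 0) :
    rewardSum h i = 0 := by
  unfold pullCount at hN
  rw [Finset.sum_eq_zero_iff] at hN
  refine Finset.sum_eq_zero fun s hs => ?_
  have := hN s hs
  split_ifs with h1
  · simp [h1] at this
  · rfl

lemma pullCount_mul_empMean (h : History K t) (i : Fin K) :
    (pullCount h i : ℝ) * empMean h i = rewardSum h i := by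
  by_cases hN : pullCount h i = 0
  · rw [hN, rewardSum_eq_zero h i hN]; simp
  · rw [empMean_eq]; field_simp

lemma postVar_appendRound (v₀ v : Fin K → ℝ≥0) (h : History K t) (a : Fin K) (x : ℝ) :
    postVar v₀ v (appendRound h (a, x)) = conjVar (postVar v₀ v h) (v a) a := by
  funext i
  by_cases hi : i = a
  · subst hi
    simp only [conjVar, Function.update_self, postVar, pullCount_appendRound, if_true]
    by_cases h0 : v₀ i = 0
    · simp [h0]
    by_cases hv : v i = 0
    · simp [h0, hv]
    simp only [h0, hv, if_false]
    have h0' : 0 < v₀ i := pos_iff_ne_zero.2 h0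
    have hv' : 0 < v i := pos_iff_ne_zero.2 hv
    push_cast
    field_simp
    ring
  · have hi' : ¬ a = i := fun h => hi h.symm
    simp [conjVar, Function.update_of_ne hi, postVar, pullCount_appendRound, hi']

/-- The identity can fail for individual `x`: when a noiseless arm has already been pulled, the
empirical mean moves with `x` while the conjugate update has gain `0`. The predictive law is then a
Dirac mass at the posterior mean, so that such `x` form a null set. -/
lemma postMean_appendRound_ae (m₀ : Fin K → ℝ) (v₀ v : Fin K → ℝ≥0) (h : History K t)
    (a : Fin K) :
    ∀ᵐ x ∂(gaussianReal (postMean m₀ v₀ v h a) (postVar v₀ v h a + v a)),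
      postMean m₀ v₀ v (appendRound h (a, x)) =
        conjMean (postMean m₀ v₀ v h) (postVar v₀ v h) (v a) a x := by
  have hne : ∀ x i, i ≠ a → postMean m₀ v₀ v (appendRound h (a, x)) i =
      conjMean (postMean m₀ v₀ v h) (postVar v₀ v h) (v a) a x i := by
    intro x i hi
    have hi' : ¬ a = i := fun h => hi h.symm
    simp [conjMean, Function.update_of_ne hi, postMean, postVar, empMean_eq,
      pullCount_appendRound, rewardSum_appendRound, hi']
  have key : ∀ᵐ x ∂(gaussianReal (postMean m₀ v₀ v h a) (postVar v₀ v h a + v a)),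
      postMean m₀ v₀ v (appendRound h (a, x)) a =
        postMean m₀ v₀ v h a + postVar v₀ v h a / (postVar v₀ v h a + v a) *
          (x - postMean m₀ v₀ v h a) := by
    by_cases h0 : v₀ a = 0
    · exact ae_of_all _ fun x => by simp [postMean, postVar, h0]
    by_cases hv : v a = 0
    · by_cases hN : pullCount h a = 0
      · refine ae_of_all _ fun x => ?_
        have h0' : (v₀ a : ℝ) ≠ 0 := by exact_mod_cast h0
        simp [postMean, postVar, h0, hv, hN, empMean_eq, pullCount_appendRound,
          rewardSum_appendRound, rewardSum_eq_zero h a hN, h0']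
      · have hs : postVar v₀ v h a + v a = 0 := by simp [postVar, h0, hv, hN]
        rw [hs, gaussianReal_zero_var, ae_dirac_eq, Filter.eventually_pure]
        have hN' : (pullCount h a : ℝ) ≠ 0 := by exact_mod_cast hN
        have hN1 : (pullCount h a : ℝ) + 1 ≠ 0 := by positivity
        simp [postMean, h0, hv, hN, empMean_eq, pullCount_appendRound,
          rewardSum_appendRound]
        field_simp
    · refine ae_of_all _ fun x => ?_
      have h0' : (0 : ℝ) < v₀ a := by exact_mod_cast pos_iff_ne_zero.2 h0
      have hv' : (0 : ℝ) < v a := by exact_mod_cast pos_iff_ne_zero.2 hv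
      have e1 : (postVar v₀ v (appendRound h (a, x)) a : ℝ) =
          postVar v₀ v h a * v a / (postVar v₀ v h a + v a) := by
        rw [postVar_appendRound]; simp [conjVar]
      have e2 : (0 : ℝ) ≤ postVar v₀ v h a := (postVar v₀ v h a).2
      simp only [postMean, h0, hv, if_false, pullCount_mul_empMean, rewardSum_appendRound,
        if_true, e1]
      field_simp
      ring
  filter_upwards [key] with x hx
  funext i
  by_cases hi : i = a
  · subst hi
    rw [hx]; simp [conjMean]
  · exact hne x i hi

/-- The posterior after a round is the conditional law of the mean rewards, when they and the
reward of that round are drawn from the posterior before the round. -/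
lemma lintegral_posterior_appendRound (m₀ : Fin K → ℝ) (v₀ v : Fin K → ℝ≥0) (h : History K t)
    (a : Fin K) {f : (Fin K → ℝ) × ℝ → ENNReal} (hf : Measurable f) :
    ∫⁻ θ, ∫⁻ x, f (θ, x) ∂(gaussianReal (θ a) (v a)) ∂(posterior t m₀ v₀ v h) =
      ∫⁻ x, ∫⁻ θ, f (θ, x) ∂(posterior (t + 1) m₀ v₀ v (appendRound h (a, x)))
        ∂(gaussianReal (postMean m₀ v₀ v h a) (postVar v₀ v h a + v a)) := by
  refine (lintegral_obs_eq_lintegral_conj _ _ (v a) a hf).trans (lintegral_congr_ae ?_)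
  filter_upwards [postMean_appendRound_ae m₀ v₀ v h a] with x hx
  change _ = ∫⁻ θ, f (θ, x) ∂(Measure.pi fun i => gaussianReal
    (postMean m₀ v₀ v (appendRound h (a, x)) i) (postVar v₀ v (appendRound h (a, x)) i))
  rw [hx, postVar_appendRound]

instance (t : ℕ) (m₀ : Fin K → ℝ) (v₀ v : Fin K → ℝ≥0) :
    IsMarkovKernel (posterior t m₀ v₀ v) :=
  ⟨fun h => by
    change IsProbabilityMeasure (Measure.pi fun i => gaussianReal _ _); infer_instance⟩

instance (t : ℕ) (m₀ : Fin K → ℝ) (v₀ v : Fin K → ℝ≥0) :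
    IsMarkovKernel (sampleLaw t m₀ v₀ v) := by
  unfold sampleLaw; infer_instance

instance (t : ℕ) (v : Fin K → ℝ≥0) : IsMarkovKernel (rewardLaw t v) :=
  ⟨fun p => by change IsProbabilityMeasure (gaussianReal _ _); infer_instance⟩

lemma posterior_zero (m₀ : Fin K → ℝ) (v₀ v : Fin K → ℝ≥0) (h : History K 0) :
    posterior 0 m₀ v₀ v h = Measure.pi fun i => gaussianReal (m₀ i) (v₀ i) := by
  have hN : ∀ i, pullCount h i = 0 := fun i => by simp [pullCount]
  have hv : ∀ i, postVar v₀ v h i = v₀ i := by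
    intro i
    by_cases h0 : v₀ i = 0
    · simp [postVar, h0]
    · by_cases h1 : v i = 0 <;> simp [postVar, h0, h1, hN]
  have hm : ∀ i, postMean m₀ v₀ v h i = m₀ i := by
    intro i
    by_cases h0 : v₀ i = 0
    · simp [postMean, h0]
    · by_cases h1 : v i = 0
      · simp [postMean, h0, h1, hN]
      · have h0' : (v₀ i : ℝ) ≠ 0 := by exact_mod_cast h0
        simp [postMean, h0, h1, hN, hv]
        field_simp
  change (Measure.pi fun i => gaussianReal (postMean m₀ v₀ v h i) (postVar v₀ v h i)) = _
  simp only [hv, hm]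

end

section

/-! ### The posterior sampling identity -/

lemma lintegral_of_hasCondDistrib {Ω S T : Type*} [MeasurableSpace Ω] [MeasurableSpace S]
    [MeasurableSpace T] {P : Measure Ω} [IsProbabilityMeasure P] {Y : Ω → T} {X : Ω → S}
    {κ : Kernel S T} [IsMarkovKernel κ] (h : HasCondDistrib Y X κ P)
    {f : S × T → ENNReal} (hf : Measurable f) :
    ∫⁻ ω, f (X ω, Y ω) ∂P = ∫⁻ ω, ∫⁻ y, f (X ω, y) ∂(κ (X ω)) ∂P := by
  have hX : AEMeasurable X P := h.aemeasurable_fst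
  have : IsProbabilityMeasure (P.map X) := Measure.isProbabilityMeasure_map hX
  rw [← lintegral_map' hf.aemeasurable h.aemeasurable, h.map_eq, Measure.lintegral_compProd hf,
    lintegral_map' hf.lintegral_kernel_prod_right'.aemeasurable hX]

variable {K : ℕ} {Ω : Type*} [MeasurableSpace Ω] {P : Measure Ω} [IsProbabilityMeasure P] {n : ℕ}
  {m₀ : Fin K → ℝ} {v₀ v : Fin K → ℝ≥0} {argmax : (Fin K → ℝ) → Fin K}
  {μ : Ω → Fin K → ℝ} {μs : ℕ → Ω → Fin K → ℝ} {A : ℕ → Ω → Fin K} {X : ℕ → Ω → ℝ}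

lemma measurable_lintegral_posterior {T : Type*} [MeasurableSpace T] {t : ℕ} {g : T → History K t}
    (hg : Measurable g) {f : T × (Fin K → ℝ) → ENNReal} (hf : Measurable f) :
    Measurable fun x => ∫⁻ θ, f (x, θ) ∂(posterior t m₀ v₀ v (g x)) :=
  hf.lintegral_kernel_prod_right' (κ := (posterior t m₀ v₀ v).comap g hg)

/-- The sampling kernel ignores the mean vector. Integrating the sample out leaves a function of the
history and the means, to which `ih` (the posterior property before round `t`) applies. -/
lemma IsGaussianTS.lintegral_sample (hTS : IsGaussianTS P n m₀ v₀ v argmax μ μs A X) {t : ℕ}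
    (ht : t < n)
    (ih : ∀ f : History K t × (Fin K → ℝ) → ENNReal, Measurable f →
      ∫⁻ ω, f (history A X t ω, μ ω) ∂P =
        ∫⁻ ω, ∫⁻ θ, f (history A X t ω, θ) ∂(posterior t m₀ v₀ v (history A X t ω)) ∂P)
    {f : (History K t × (Fin K → ℝ)) × (Fin K → ℝ) → ENNReal} (hf : Measurable f) :
    ∫⁻ ω, f ((history A X t ω, μ ω), μs t ω) ∂P =
      ∫⁻ ω, ∫⁻ θ, ∫⁻ θs, f ((history A X t ω, θ), θs) ∂(posterior t m₀ v₀ v (history A X t ω))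
        ∂(posterior t m₀ v₀ v (history A X t ω)) ∂P := by
  have h1 := lintegral_of_hasCondDistrib (hTS.sample t ht)
    (f := fun p => f ((p.1.2, p.1.1), p.2)) (hf.comp (by fun_prop))
  simp only [sampleLaw, Kernel.comap_apply] at h1
  rw [h1]
  exact ih (fun p => ∫⁻ θs, f (p, θs) ∂(posterior t m₀ v₀ v p.1))
    (measurable_lintegral_posterior measurable_fst hf)

/-- One round of the induction: the reward and the sample are integrated out, and conjugacy then
moves the integral over the means innermost, against the updated posterior. -/
lemma IsGaussianTS.lintegral_reward (hTS : IsGaussianTS P n m₀ v₀ v argmax μ μs A X)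
    (hm : Measurable argmax) {t : ℕ} (ht : t < n)
    (ih : ∀ f : History K t × (Fin K → ℝ) → ENNReal, Measurable f →
      ∫⁻ ω, f (history A X t ω, μ ω) ∂P =
        ∫⁻ ω, ∫⁻ θ, f (history A X t ω, θ) ∂(posterior t m₀ v₀ v (history A X t ω)) ∂P)
    {f : History K (t + 1) × (Fin K → ℝ) → ENNReal} (hf : Measurable f) :
    ∫⁻ ω, f (history A X (t + 1) ω, μ ω) ∂P =
      ∫⁻ ω, ∫⁻ θs, ∫⁻ x, ∫⁻ θ, f (appendRound (history A X t ω) (argmax θs, x), θ)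
          ∂(posterior (t + 1) m₀ v₀ v (appendRound (history A X t ω) (argmax θs, x)))
        ∂(gaussianReal (postMean m₀ v₀ v (history A X t ω) (argmax θs))
          (postVar v₀ v (history A X t ω) (argmax θs) + v (argmax θs)))
        ∂(posterior t m₀ v₀ v (history A X t ω)) ∂P := by
  have hF : Measurable fun p : (((Fin K → ℝ) × History K t) × Fin K) × ℝ =>
      f (appendRound p.1.1.2 (p.1.2, p.2), p.1.1.1) :=
    hf.comp (.prodMk (.appendRound (by fun_prop) (by fun_prop)) (by fun_prop))
  have h1 := lintegral_of_hasCondDistrib (hTS.reward t ht) hF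
  have hG : Measurable fun p : ((Fin K → ℝ) × History K t) × Fin K =>
      ∫⁻ x, f (appendRound p.1.2 (p.2, x), p.1.1) ∂(rewardLaw t v p) :=
    hF.lintegral_kernel_prod_right'
  have h2 : ∫⁻ ω, (∫⁻ x, f (appendRound (history A X t ω) (A t ω, x), μ ω)
        ∂(rewardLaw t v ((μ ω, history A X t ω), A t ω))) ∂P =
      ∫⁻ ω, (∫⁻ x, f (appendRound (history A X t ω) (argmax (μs t ω), x), μ ω)
        ∂(rewardLaw t v ((μ ω, history A X t ω), argmax (μs t ω)))) ∂P := by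
    refine lintegral_congr_ae ?_
    filter_upwards [hTS.pull t ht] with ω hω
    rw [hω]
  have hG' : Measurable fun p : (History K t × (Fin K → ℝ)) × (Fin K → ℝ) =>
      ∫⁻ x, f (appendRound p.1.1 (argmax p.2, x), p.1.2)
        ∂(rewardLaw t v ((p.1.2, p.1.1), argmax p.2)) :=
    hG.comp (by fun_prop)
  have h3 := hTS.lintegral_sample ht ih hG'
  simp only [history_succ]
  rw [h1, h2, h3]
  refine lintegral_congr fun ω => ?_
  -- The pulled arm depends on the sample only. With the sample outermost, conjugacy is applied for
  -- a fixed arm.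
  rw [lintegral_lintegral_swap]
  · refine lintegral_congr fun θs => ?_
    have hH : Measurable fun p : (Fin K → ℝ) × ℝ =>
        f (appendRound (history A X t ω) (argmax θs, p.2), p.1) :=
      hf.comp (.prodMk (.appendRound (by fun_prop) (by fun_prop)) (by fun_prop))
    exact lintegral_posterior_appendRound m₀ v₀ v (history A X t ω) (argmax θs) hH
  · exact (hG'.comp (by fun_prop : Measurable fun p : (Fin K → ℝ) × (Fin K → ℝ) =>
      ((history A X t ω, p.1), p.2))).aemeasurable

/-- The posterior is the conditional law of the mean rewards given the history. -/
theorem IsGaussianTS.lintegral_posterior (hTS : IsGaussianTS P n m₀ v₀ v argmax μ μs A X)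
    (hm : Measurable argmax) {t : ℕ} (ht : t ≤ n) :
    ∀ f : History K t × (Fin K → ℝ) → ENNReal, Measurable f →
      ∫⁻ ω, f (history A X t ω, μ ω) ∂P =
        ∫⁻ ω, ∫⁻ θ, f (history A X t ω, θ) ∂(posterior t m₀ v₀ v (history A X t ω)) ∂P := by
  induction t with
  | zero =>
    intro f hf
    have hh : ∀ ω, history A X 0 ω = default := fun ω => Subsingleton.elim _ _
    simp only [hh, posterior_zero, lintegral_const, measure_univ, mul_one]
    have hf' : Measurable fun θ => f (default, θ) := hf.comp (by fun_prop)
    rw [← hTS.prior.map_eq, lintegral_map' hf'.aemeasurable hTS.prior.aemeasurable]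
  | succ t ih =>
    intro f hf
    have ht' : t < n := ht
    have ih' := ih ht'.le
    rw [hTS.lintegral_reward hm ht' ih' hf]
    -- The right-hand side is itself the expectation of a function of the new history and the means
    -- that is constant in the means. Expanding it by the same lemma gives the same iterated
    -- integral, because averaging a constant over the posterior changes nothing.
    have hF : Measurable fun p : History K (t + 1) × (Fin K → ℝ) =>
        ∫⁻ θ, f (p.1, θ) ∂(posterior (t + 1) m₀ v₀ v p.1) :=
      (measurable_lintegral_posterior measurable_id hf).comp measurable_fst
    rw [hTS.lintegral_reward hm ht' ih' hF]
    simp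

/-- Given the history, the mean rewards and the posterior sample are independent draws from the
posterior. -/
theorem IsGaussianTS.map_history_mean_sample (hTS : IsGaussianTS P n m₀ v₀ v argmax μ μs A X)
    (hm : Measurable argmax) {t : ℕ} (ht : t < n) :
    P.map (fun ω => (history A X t ω, (μ ω, μs t ω))) =
      (P.map (history A X t)) ⊗ₘ (posterior t m₀ v₀ v ×ₖ posterior t m₀ v₀ v) := by
  have hH : AEMeasurable (history A X t) P := (hTS.sample t ht).aemeasurable_fst.snd
  have hμ : AEMeasurable μ P := hTS.prior.aemeasurable
  have hs : AEMeasurable (μs t) P := (hTS.sample t ht).aemeasurable_snd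
  have : IsProbabilityMeasure (P.map (history A X t)) := Measure.isProbabilityMeasure_map hH
  refine Measure.ext_of_lintegral _ fun f hf => ?_
  rw [lintegral_map' hf.aemeasurable (hH.prodMk (hμ.prodMk hs)), Measure.lintegral_compProd hf,
    lintegral_map' hf.lintegral_kernel_prod_right'.aemeasurable hH]
  have h := hTS.lintegral_sample ht (hTS.lintegral_posterior hm ht.le)
    (f := fun p => f (p.1.1, (p.1.2, p.2))) (hf.comp (by fun_prop))
  rw [h]
  refine lintegral_congr fun ω => ?_
  rw [Kernel.prod_apply, lintegral_prod]
  exact (hf.comp (by fun_prop : Measurable fun p : (Fin K → ℝ) × (Fin K → ℝ) =>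
      (history A X t ω, p))).aemeasurable

end

/-! ### Deviations of the best arm under a product of Gaussians -/

lemma integral_Ioi_mul_exp_neg_sq_div_two (c : ℝ) :
    IntegrableOn (fun z : ℝ => z * Real.exp (-z ^ 2 / 2)) (Set.Ioi c) ∧
      ∫ z in Set.Ioi c, z * Real.exp (-z ^ 2 / 2) = Real.exp (-c ^ 2 / 2) := by
  have hint : Integrable (fun z : ℝ => z * Real.exp (-z ^ 2 / 2)) := by
    have := integrable_mul_exp_neg_mul_sq (b := 1 / 2) (by norm_num)
    refine this.congr (ae_of_all _ fun z => ?_)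
    ring_nf
  refine ⟨hint.integrableOn, ?_⟩
  have hd : ∀ x ∈ Set.Ici c, HasDerivAt (fun z : ℝ => -Real.exp (-z ^ 2 / 2))
      (x * Real.exp (-x ^ 2 / 2)) x := by
    intro x _
    have h1 : HasDerivAt (fun z : ℝ => -z ^ 2 / 2) (-x) x := by
      have := ((hasDerivAt_pow 2 x).neg).div_const 2
      exact this.congr_deriv (by ring)
    exact h1.exp.neg.congr_deriv (by ring)
  have ht : Filter.Tendsto (fun z : ℝ => -Real.exp (-z ^ 2 / 2)) Filter.atTop (nhds 0) := by
    rw [show (0 : ℝ) = -0 by simp]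
    refine (Real.tendsto_exp_atBot.comp ?_).neg
    have : Filter.Tendsto (fun z : ℝ => z ^ 2 / 2) Filter.atTop Filter.atTop :=
      (Filter.tendsto_pow_atTop (by norm_num)).atTop_div_const (by norm_num)
    refine (Filter.tendsto_neg_atTop_atBot.comp this).congr fun z => ?_
    simp only [Function.comp]; ring
  rw [integral_Ioi_of_hasDerivAt_of_tendsto' hd hint.integrableOn ht]
  ring

/-- For `c ≥ 0` the excess `(z - c)⁺` is at most `z` on `z > c`, and `z * exp (-z²/2)` has an
explicit antiderivative. -/
lemma integral_max_sub_stdGaussian_le {c : ℝ} (hc : 0 ≤ c) :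
    ∫ z, max (z - c) 0 ∂(gaussianReal 0 1) ≤ (√(2 * Real.pi))⁻¹ * Real.exp (-c ^ 2 / 2) := by
  obtain ⟨hi, he⟩ := integral_Ioi_mul_exp_neg_sq_div_two c
  rw [integral_gaussianReal_eq_integral_smul one_ne_zero, ← he, ← integral_const_mul,
    ← integral_indicator measurableSet_Ioi]
  refine integral_mono_of_nonneg (ae_of_all _ fun z => ?_)
    ((integrable_indicator_iff measurableSet_Ioi).2 (hi.const_mul _)) (ae_of_all _ fun z => ?_)
  · exact mul_nonneg (gaussianPDFReal_nonneg _ _ _) (le_max_right _ _)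
  · simp only [Set.indicator_apply, Set.mem_Ioi, gaussianPDFReal, smul_eq_mul, NNReal.coe_one,
      mul_one, sub_zero]
    split_ifs with h
    · rw [max_eq_left (by linarith), mul_assoc, mul_comm z]
      gcongr
      linarith
    · rw [max_eq_right (by linarith)]; simp

lemma integral_max_sub_gaussianReal_le (m : ℝ) (s : ℝ≥0) {c : ℝ} (hc : 0 ≤ c) :
    ∫ y, max (y - (m + c * √(s : ℝ))) 0 ∂(gaussianReal m s) ≤
      √(s : ℝ) * ((√(2 * Real.pi))⁻¹ * Real.exp (-c ^ 2 / 2)) := by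
  rw [gaussianReal_eq_map_std, integral_map (by fun_prop) (by fun_prop)]
  refine le_trans (le_of_eq ?_)
    (mul_le_mul_of_nonneg_left (integral_max_sub_stdGaussian_le hc) (Real.sqrt_nonneg _))
  rw [← integral_const_mul]
  refine integral_congr_ae (ae_of_all _ fun z => ?_)
  simp only
  rw [mul_max_of_nonneg _ _ (Real.sqrt_nonneg _)]
  congr 1 <;> ring

lemma measurable_apply_of_countable {T ι E : Type*} [MeasurableSpace T] [MeasurableSpace E]
    [Countable ι] [MeasurableSpace ι] [MeasurableSingletonClass ι] {g : T → ι → E} {a : T → ι}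
    (hg : Measurable g) (ha : Measurable a) : Measurable fun x => g x (a x) := by
  have h : Measurable fun p : (ι → E) × ι => p.1 p.2 :=
    measurable_from_prod_countable_left fun i => measurable_pi_apply i
  exact h.comp (hg.prodMk ha)

section PiGaussian

variable {K : ℕ} (m : Fin K → ℝ) (s : Fin K → ℝ≥0)

lemma integrable_eval_pi_gaussianReal (i : Fin K) :
    Integrable (fun θ : Fin K → ℝ => θ i) (Measure.pi fun i => gaussianReal (m i) (s i)) :=
  (measurePreserving_eval (fun i => gaussianReal (m i) (s i)) i).integrable_comp_of_integrable
    (g := fun y => y) ((memLp_id_gaussianReal 1).integrable le_rfl)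

lemma integral_comp_eval_pi_gaussianReal (i : Fin K) {f : ℝ → ℝ} (hf : Measurable f) :
    ∫ θ, f (θ i) ∂(Measure.pi fun i => gaussianReal (m i) (s i)) =
      ∫ y, f y ∂(gaussianReal (m i) (s i)) := by
  rw [← (measurePreserving_eval (fun i => gaussianReal (m i) (s i)) i).map_eq,
    integral_map (measurable_pi_apply i).aemeasurable hf.aestronglyMeasurable]

/-- A selected coordinate of an integrable vector is integrable. -/
lemma integrable_apply_select {T : Type*} [MeasurableSpace T] {ρ : Measure T}
    {g : T → Fin K → ℝ} {a : T → Fin K} (hga : AEStronglyMeasurable (fun x => g x (a x)) ρ)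
    (hi : ∀ i, Integrable (fun x => g x i) ρ) : Integrable (fun x => g x (a x)) ρ := by
  refine Integrable.mono' (integrable_finsetSum Finset.univ fun i _ => (hi i).norm)
    hga (ae_of_all _ fun x => ?_)
  exact Finset.single_le_sum (f := fun i => ‖g x i‖) (fun i _ => norm_nonneg _)
    (Finset.mem_univ (a x))

/-- The gap between the best coordinate of one draw, and the coordinate of the same draw that is
best in an independent second draw. -/
theorem integral_prod_gap_le {argmax : (Fin K → ℝ) → Fin K} (hm : Measurable argmax) {c : ℝ}
    (hc : 0 ≤ c) :
    ∫ p, (p.1 (argmax p.1) - p.1 (argmax p.2))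
        ∂((Measure.pi fun i => gaussianReal (m i) (s i)).prod
          (Measure.pi fun i => gaussianReal (m i) (s i))) ≤
      ∫ p, (c * √(s (argmax p.2) : ℝ)
          + ∑ i, √(s i : ℝ) * ((√(2 * Real.pi))⁻¹ * Real.exp (-c ^ 2 / 2)))
        ∂((Measure.pi fun i => gaussianReal (m i) (s i)).prod
          (Measure.pi fun i => gaussianReal (m i) (s i))) := by
  set ρ := Measure.pi fun i => gaussianReal (m i) (s i) with hρ
  have h1 : Integrable (fun θ : Fin K → ℝ => θ (argmax θ)) ρ :=
    integrable_apply_select (g := fun θ => θ)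
      (measurable_apply_of_countable measurable_id hm).aestronglyMeasurable
      (integrable_eval_pi_gaussianReal m s)
  have hsel : ∀ w : Fin K → ℝ, Integrable (fun θ => w (argmax θ)) ρ := fun w =>
    integrable_apply_select (g := fun _ => w)
      (measurable_apply_of_countable measurable_const hm).aestronglyMeasurable
      (fun i => integrable_const _)
  have h2 : Integrable (fun p : (Fin K → ℝ) × (Fin K → ℝ) => p.1 (argmax p.2)) (ρ.prod ρ) :=
    integrable_apply_select (g := fun p : (Fin K → ℝ) × (Fin K → ℝ) => p.1)
      (measurable_apply_of_countable measurable_fst (hm.comp measurable_snd)).aestronglyMeasurable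
      (fun i => (integrable_eval_pi_gaussianReal m s i).comp_fst ρ)
  have e1 : ∫ p : (Fin K → ℝ) × (Fin K → ℝ), p.1 (argmax p.1) ∂(ρ.prod ρ) =
      ∫ θ, θ (argmax θ) ∂ρ := by
    rw [integral_fun_fst (fun θ : Fin K → ℝ => θ (argmax θ))]; simp
  -- By independence the arm can be frozen while the first draw is averaged, which leaves the mean
  -- of that arm.
  have e2 : ∫ p : (Fin K → ℝ) × (Fin K → ℝ), p.1 (argmax p.2) ∂(ρ.prod ρ) =
      ∫ θ, m (argmax θ) ∂ρ := by
    rw [integral_prod_symm _ h2]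
    refine integral_congr_ae (ae_of_all _ fun θs => ?_)
    simp only
    exact (integral_comp_eval_pi_gaussianReal m s _ measurable_id).trans
      integral_id_gaussianReal
  -- As both draws have law `ρ`, every term becomes an integral over one draw `θ`, and the gap turns
  -- into the deviation of the selected coordinate from its mean.
  rw [integral_sub (h1.comp_fst ρ) h2, e1, e2,
    integral_fun_snd (fun θ : Fin K → ℝ => c * √(s (argmax θ) : ℝ)
      + ∑ i, √(s i : ℝ) * ((√(2 * Real.pi))⁻¹ * Real.exp (-c ^ 2 / 2))),
    ← integral_sub h1 (hsel m)]
  simp only [probReal_univ, one_smul]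
  have h3 : ∀ i, Integrable (fun θ : Fin K → ℝ => max (θ i - (m i + c * √(s i : ℝ))) 0) ρ :=
    fun i => ((integrable_eval_pi_gaussianReal m s i).sub (integrable_const _)).pos_part
  have h4 : Integrable (fun θ => c * √(s (argmax θ) : ℝ)) ρ := hsel fun i => c * √(s i : ℝ)
  -- Since the selected arm is random, its excess over the upper confidence bound is dominated by
  -- the sum of the excesses of all arms.
  calc ∫ θ, (θ (argmax θ) - m (argmax θ)) ∂ρ
      ≤ ∫ θ, (c * √(s (argmax θ) : ℝ) + ∑ i, max (θ i - (m i + c * √(s i : ℝ))) 0) ∂ρ := by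
        refine integral_mono (h1.sub (hsel m)) (h4.add (integrable_finsetSum _ fun i _ => h3 i))
          fun θ => ?_
        have := Finset.single_le_sum (f := fun i => max (θ i - (m i + c * √(s i : ℝ))) 0)
          (fun i _ => le_max_right _ _) (Finset.mem_univ (argmax θ))
        have h5 := le_max_left (θ (argmax θ) - (m (argmax θ) + c * √(s (argmax θ) : ℝ))) 0
        simp only at this ⊢
        linarith
    _ = ∫ θ, c * √(s (argmax θ) : ℝ) ∂ρ
        + ∑ i, ∫ θ, max (θ i - (m i + c * √(s i : ℝ))) 0 ∂ρ := by
        rw [integral_add h4 (integrable_finsetSum _ fun i _ => h3 i),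
          integral_finsetSum _ fun i _ => h3 i]
    _ ≤ ∫ θ, c * √(s (argmax θ) : ℝ) ∂ρ
        + ∑ i, √(s i : ℝ) * ((√(2 * Real.pi))⁻¹ * Real.exp (-c ^ 2 / 2)) := by
        gcongr with i
        rw [hρ, integral_comp_eval_pi_gaussianReal m s i
          (f := fun y => max (y - (m i + c * √(s i : ℝ))) 0) (by fun_prop)]
        exact integral_max_sub_gaussianReal_le _ _ hc
    _ = _ := by
        rw [integral_add h4 (integrable_const _)]; simp

end PiGaussian

section

/-! ### Sums of posterior variances -/

/-- Posterior variance after `N` pulls. -/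
def countVar (w u : ℝ≥0) (N : ℕ) : ℝ≥0 :=
  if w = 0 then 0 else if u = 0 then (if N = 0 then w else 0) else 1 / (1 / w + (N : ℝ≥0) / u)

lemma countVar_le (w u : ℝ≥0) (N : ℕ) : countVar w u N ≤ w := by
  unfold countVar
  split_ifs with h0 h1 h2
  · exact zero_le
  · exact le_rfl
  · exact zero_le
  · have h0' : 0 < w := pos_iff_ne_zero.2 h0
    calc 1 / (1 / w + (N : ℝ≥0) / u) ≤ 1 / (1 / w) := by
          gcongr
          exact le_self_add
      _ = w := by simp

lemma mul_log_nonneg (w u : ℝ≥0) (n : ℕ) :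
    0 ≤ (u : ℝ) * Real.log (1 + n * (w : ℝ) / (u : ℝ)) := by
  refine mul_nonneg u.2 (Real.log_nonneg ?_)
  have : (0 : ℝ) ≤ n * (w : ℝ) / (u : ℝ) := by positivity
  linarith

/-- Monotonicity in the variance `u` is Bernoulli's inequality `(1 + x)^p ≤ 1 + p * x` with `p = u'
/ u ≤ 1` and `x = n * w / u'`, after taking logarithms. -/
lemma mul_log_mono {w w' u u' : ℝ≥0} (hw : w' ≤ w) (hu : u' ≤ u) {n n' : ℕ} (hn : n' ≤ n) :
    (u' : ℝ) * Real.log (1 + n' * (w' : ℝ) / (u' : ℝ)) ≤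
      (u : ℝ) * Real.log (1 + n * (w : ℝ) / (u : ℝ)) := by
  by_cases h0 : u' = 0
  · rw [h0]
    simpa using mul_log_nonneg w u n
  have hu'0 : (0 : ℝ) < u' := by exact_mod_cast pos_iff_ne_zero.2 h0
  have hu' : (u' : ℝ) ≤ u := by exact_mod_cast hu
  have hu0 : (0 : ℝ) < u := hu'0.trans_le hu'
  have hw' : (w' : ℝ) ≤ w := by exact_mod_cast hw
  have hn' : (n' : ℝ) ≤ n := by exact_mod_cast hn
  have hx : (0 : ℝ) ≤ n * (w : ℝ) / u' := by positivity
  have h1 : (u' : ℝ) * Real.log (1 + n' * (w' : ℝ) / (u' : ℝ)) ≤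
      u' * Real.log (1 + n * (w : ℝ) / (u' : ℝ)) := by
    gcongr
  have h2 := rpow_one_add_le_one_add_mul_self (s := n * (w : ℝ) / u') (p := (u' : ℝ) / u)
    (by linarith) (by positivity) ((div_le_one hu0).2 hu')
  have h3 := Real.log_le_log (by positivity) h2
  rw [Real.log_rpow (by linarith)] at h3
  have h4 : (u' : ℝ) / u * (n * (w : ℝ) / u') = n * w / u := by field_simp
  rw [h4, div_mul_eq_mul_div, div_le_iff₀ hu0] at h3
  linarith

/-- With `a = 1 + M * w / u` and `b = 1 + (M + 1) * w / u`, the variance after `M + 1` pulls equals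
`u * (1 - a / b)`, which is at most `u * log (b / a)`. These bounds telescope; the variance before
the first pull is `w`. -/
lemma sum_countVar_le (w u : ℝ≥0) (M : ℕ) :
    ∑ N ∈ Finset.range M, (countVar w u N : ℝ) ≤
      w + u * Real.log (1 + M * (w : ℝ) / (u : ℝ)) := by
  cases M with
  | zero => simp
  | succ M =>
    -- One of the `M + 1` terms is paid for by `w`, so `M` logarithmic increments suffice for the
    -- others.
    refine le_trans ?_ (add_le_add_right (mul_log_mono le_rfl le_rfl (Nat.le_succ M)) _)
    induction M with
    | zero =>
      have := countVar_le w u 0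
      simpa using this
    | succ M ih =>
      rw [Finset.sum_range_succ]
      have key : (countVar w u (M + 1) : ℝ) ≤ u * Real.log (1 + (M + 1 : ℕ) * (w : ℝ) / (u : ℝ))
          - u * Real.log (1 + M * (w : ℝ) / (u : ℝ)) := by
        by_cases h0 : w = 0
        · simp [countVar, h0]
        by_cases h1 : u = 0
        · simp [countVar, h0, h1]
        have h0' : (0 : ℝ) < w := by exact_mod_cast pos_iff_ne_zero.2 h0
        have h1' : (0 : ℝ) < u := by exact_mod_cast pos_iff_ne_zero.2 h1
        have ha : (0 : ℝ) < 1 + M * (w : ℝ) / u := by positivity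
        have hb : (0 : ℝ) < 1 + (M + 1 : ℕ) * (w : ℝ) / u := by positivity
        rw [← mul_sub, ← Real.log_div hb.ne' ha.ne']
        have := Real.one_sub_inv_le_log_of_pos (div_pos hb ha)
        refine le_trans (le_of_eq ?_) (mul_le_mul_of_nonneg_left this h1'.le)
        simp only [countVar, h0, h1, if_false]
        push_cast
        field_simp
        ring
      linarith

variable {K : ℕ} {Ω : Type*}

lemma postVar_eq_countVar {t : ℕ} (v₀ v : Fin K → ℝ≥0) (h : History K t) (i : Fin K) :
    postVar v₀ v h i = countVar (v₀ i) (v i) (pullCount h i) := rfl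

lemma postVar_le {t : ℕ} (v₀ v : Fin K → ℝ≥0) (h : History K t) (i : Fin K) :
    postVar v₀ v h i ≤ v₀ i := countVar_le _ _ _

lemma pullCount_le {t : ℕ} (h : History K t) (i : Fin K) : pullCount h i ≤ t := by
  refine (Finset.sum_le_card_nsmul _ _ 1 fun s _ => ?_).trans (by simp)
  split_ifs <;> simp

/-- Rounds are regrouped by arm: successive pulls of an arm meet the counts `0, 1, 2, …`, and the
posterior variance depends on the history through the count only. -/
lemma sum_postVar_eq (v₀ v : Fin K → ℝ≥0) (A : ℕ → Ω → Fin K) (X : ℕ → Ω → ℝ) (n : ℕ) (ω : Ω) :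
    ∑ t ∈ Finset.range n, (postVar v₀ v (history A X t ω) (A t ω) : ℝ) =
      ∑ i, ∑ N ∈ Finset.range (pullCount (history A X n ω) i), (countVar (v₀ i) (v i) N : ℝ) := by
  induction n with
  | zero => simp [pullCount]
  | succ n ih =>
    rw [Finset.sum_range_succ, ih, history_succ]
    simp only [pullCount_appendRound]
    have : ∀ i, ∑ N ∈ Finset.range (pullCount (history A X n ω) i + if A n ω = i then 1 else 0),
        (countVar (v₀ i) (v i) N : ℝ) =
        ∑ N ∈ Finset.range (pullCount (history A X n ω) i), (countVar (v₀ i) (v i) N : ℝ) +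
        if A n ω = i then (postVar v₀ v (history A X n ω) i : ℝ) else 0 := by
      intro i
      split_ifs with h
      · rw [Finset.sum_range_succ, postVar_eq_countVar]
      · simp
    rw [Finset.sum_congr rfl fun i _ => this i, Finset.sum_add_distrib]
    simp

lemma sum_postVar_le (v₀ v : Fin K → ℝ≥0) (A : ℕ → Ω → Fin K) (X : ℕ → Ω → ℝ) (n : ℕ) (ω : Ω) :
    ∑ t ∈ Finset.range n, (postVar v₀ v (history A X t ω) (A t ω) : ℝ) ≤
      ∑ i, (v i : ℝ) * Real.log (1 + n * (v₀ i : ℝ) / (v i : ℝ)) + ∑ i, (v₀ i : ℝ) := by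
  rw [sum_postVar_eq, ← Finset.sum_add_distrib]
  refine Finset.sum_le_sum fun i _ => (sum_countVar_le _ _ _).trans ?_
  rw [add_comm]
  exact add_le_add_left (mul_log_mono le_rfl le_rfl (pullCount_le _ _)) _

/-- Cauchy–Schwarz over the rounds, on each path separately. -/
lemma sum_sqrt_postVar_le (v₀ v : Fin K → ℝ≥0) (A : ℕ → Ω → Fin K) (X : ℕ → Ω → ℝ) (n : ℕ)
    (ω : Ω) :
    ∑ t ∈ Finset.range n, √(postVar v₀ v (history A X t ω) (A t ω) : ℝ) ≤
      √(n * (∑ i, (v i : ℝ) * Real.log (1 + n * (v₀ i : ℝ) / (v i : ℝ)) + ∑ i, (v₀ i : ℝ))) := by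
  refine Real.le_sqrt_of_sq_le ?_
  have h := sq_sum_le_card_mul_sum_sq (s := Finset.range n)
    (f := fun t => √(postVar v₀ v (history A X t ω) (A t ω) : ℝ))
  simp only [Finset.card_range, Real.sq_sqrt (NNReal.coe_nonneg _)] at h
  exact h.trans (mul_le_mul_of_nonneg_left (sum_postVar_le v₀ v A X n ω) (by positivity))

theorem regretBound_mono {n : ℕ} {δ : ℝ} (hδ : 0 < δ) {v₀ v v₀' v' : Fin K → ℝ≥0}
    (h₀ : ∀ i, v₀' i ≤ v₀ i) (h : ∀ i, v' i ≤ v i) :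
    regretBound n δ v₀' v' ≤ regretBound n δ v₀ v := by
  have h₀' : ∀ i, (v₀' i : ℝ) ≤ v₀ i := fun i => by exact_mod_cast h₀ i
  unfold regretBound
  simp only [← Finset.sum_mul]
  refine add_le_add (add_le_add ?_ ?_) ?_
  · by_cases hl : 0 ≤ Real.log (1 / δ)
    · refine mul_le_mul_of_nonneg_left (Real.sqrt_le_sqrt (mul_le_mul_of_nonneg_right
        (Finset.sum_le_sum fun i _ => ?_) hl)) (Real.sqrt_nonneg _)
      exact mul_log_mono (h₀ i) (h i) le_rfl
    -- For `δ > 1` the radicand is nonpositive, so the smaller side vanishes.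
    · rw [Real.sqrt_eq_zero_of_nonpos (x := _ * Real.log (1 / δ)), mul_zero]
      · positivity
      · exact mul_nonpos_of_nonneg_of_nonpos (Finset.sum_nonneg fun i _ => mul_log_nonneg _ _ _)
          (not_le.1 hl).le
  · by_cases hl : 0 ≤ Real.log (1 / δ)
    · gcongr with i
      exact h₀' i
    · rw [Real.sqrt_eq_zero_of_nonpos]
      · positivity
      · exact mul_nonpos_of_nonneg_of_nonpos (by positivity)
          (mul_nonpos_of_nonneg_of_nonpos (Finset.sum_nonneg fun i _ => (v₀' i).2)
            (not_le.1 hl).le)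
  · gcongr with i
    exact h₀' i

end

section

/-! ### The regret bound -/

variable {K : ℕ} {Ω : Type*} [MeasurableSpace Ω] {P : Measure Ω} {n : ℕ}
  {m₀ : Fin K → ℝ} {v₀ v : Fin K → ℝ≥0} {argmax : (Fin K → ℝ) → Fin K}
  {μ : Ω → Fin K → ℝ} {μs : ℕ → Ω → Fin K → ℝ} {A : ℕ → Ω → Fin K} {X : ℕ → Ω → ℝ}

lemma IsGaussianTS.integrable_mean (hTS : IsGaussianTS P n m₀ v₀ v argmax μ μs A X) (i : Fin K) :
    Integrable (fun ω => μ ω i) P := by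
  have h := integrable_eval_pi_gaussianReal m₀ v₀ i
  rw [← hTS.prior.map_eq] at h
  exact h.comp_aemeasurable hTS.prior.aemeasurable

lemma IsGaussianTS.integrable_gap (hTS : IsGaussianTS P n m₀ v₀ v argmax μ μs A X)
    (hm : Measurable argmax) {t : ℕ} (ht : t < n) :
    Integrable (fun ω => μ ω (argmax (μ ω)) - μ ω (A t ω)) P := by
  have hμ : AEMeasurable μ P := hTS.prior.aemeasurable
  have hA : AEMeasurable (A t) P := (hTS.reward t ht).aemeasurable_fst.snd
  have hsel : Measurable fun p : (Fin K → ℝ) × Fin K => p.1 p.2 :=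
    measurable_apply_of_countable measurable_fst measurable_snd
  exact (integrable_apply_select
      (hsel.comp_aemeasurable (hμ.prodMk (hm.comp_aemeasurable hμ))).aestronglyMeasurable
      hTS.integrable_mean).sub
    (integrable_apply_select (hsel.comp_aemeasurable (hμ.prodMk hA)).aestronglyMeasurable
      hTS.integrable_mean)

lemma IsGaussianTS.integrable_regret (hTS : IsGaussianTS P n m₀ v₀ v argmax μ μs A X)
    (hm : Measurable argmax) : Integrable (regret n argmax μ A) P :=
  integrable_finsetSum _ fun _ ht => hTS.integrable_gap hm (Finset.mem_range.1 ht)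

lemma measurable_sqrt_postVar_apply {T : Type*} [MeasurableSpace T] {t : ℕ} {g : T → History K t}
    {a : T → Fin K} (hg : Measurable g) (ha : Measurable a) :
    Measurable fun x => √(postVar v₀ v (g x) (a x) : ℝ) :=
  (measurable_apply_of_countable ((measurable_postVar v₀ v).comp hg) ha).coe_nnreal_real.sqrt

lemma sqrt_postVar_le {t : ℕ} (h : History K t) (i : Fin K) :
    √(postVar v₀ v h i : ℝ) ≤ ∑ j, √(v₀ j : ℝ) :=
  (Real.sqrt_le_sqrt (NNReal.coe_le_coe.2 (postVar_le v₀ v h i))).trans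
    (Finset.single_le_sum (f := fun j => √(v₀ j : ℝ)) (fun _ _ => Real.sqrt_nonneg _)
      (Finset.mem_univ i))

variable [IsProbabilityMeasure P]

lemma IsGaussianTS.integrable_sqrt_postVar (hTS : IsGaussianTS P n m₀ v₀ v argmax μ μs A X)
    {t : ℕ} (ht : t < n) :
    Integrable (fun ω => √(postVar v₀ v (history A X t ω) (A t ω) : ℝ)) P := by
  have hA : AEMeasurable (fun ω => (history A X t ω, A t ω)) P :=
    (hTS.reward t ht).aemeasurable_fst.fst.snd.prodMk (hTS.reward t ht).aemeasurable_fst.snd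
  refine Integrable.of_bound (C := ∑ j, √(v₀ j : ℝ))
    ((measurable_sqrt_postVar_apply measurable_fst measurable_snd).comp_aemeasurable
      hA).aestronglyMeasurable (ae_of_all _ fun ω => ?_)
  rw [Real.norm_of_nonneg (Real.sqrt_nonneg _)]
  exact sqrt_postVar_le _ _

/-- The expected regret of one round is at most the expected width of the confidence interval of
the pulled arm, plus the expected violation of the confidence intervals. -/
theorem IsGaussianTS.integral_gap_le (hTS : IsGaussianTS P n m₀ v₀ v argmax μ μs A X)
    (hm : Measurable argmax) {t : ℕ} (ht : t < n) {c : ℝ} (hc : 0 ≤ c) :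
    ∫ ω, (μ ω (argmax (μ ω)) - μ ω (A t ω)) ∂P ≤
      ∫ ω, (c * √(postVar v₀ v (history A X t ω) (A t ω) : ℝ)
        + ∑ i, √(v₀ i : ℝ) * ((√(2 * Real.pi))⁻¹ * Real.exp (-c ^ 2 / 2))) ∂P := by
  set e : ℝ := (√(2 * Real.pi))⁻¹ * Real.exp (-c ^ 2 / 2) with he
  have he0 : 0 ≤ e := by positivity
  have hμ : AEMeasurable μ P := hTS.prior.aemeasurable
  have hH : AEMeasurable (history A X t) P := (hTS.sample t ht).aemeasurable_fst.snd
  have hs : AEMeasurable (μs t) P := (hTS.sample t ht).aemeasurable_snd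
  have : IsProbabilityMeasure (P.map (history A X t)) := Measure.isProbabilityMeasure_map hH
  have hall : AEMeasurable (fun ω => (history A X t ω, (μ ω, μs t ω))) P :=
    hH.prodMk (hμ.prodMk hs)
  have hmap := hTS.map_history_mean_sample hm ht
  let g : History K t × ((Fin K → ℝ) × (Fin K → ℝ)) → ℝ :=
    fun p => p.2.1 (argmax p.2.1) - p.2.1 (argmax p.2.2)
  let G : History K t × ((Fin K → ℝ) × (Fin K → ℝ)) → ℝ :=
    fun p => c * √(postVar v₀ v p.1 (argmax p.2.2) : ℝ) + ∑ i, √(v₀ i : ℝ) * e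
  have hg : Measurable g :=
    (measurable_apply_of_countable (g := fun p : History K t × ((Fin K → ℝ) × (Fin K → ℝ)) => p.2.1)
      (by fun_prop) (by fun_prop)).sub
    (measurable_apply_of_countable (g := fun p : History K t × ((Fin K → ℝ) × (Fin K → ℝ)) => p.2.1)
      (by fun_prop) (by fun_prop))
  have hG : Measurable G :=
    ((measurable_sqrt_postVar_apply measurable_fst (by fun_prop)).const_mul c).add_const _
  have e1 : (fun ω => μ ω (argmax (μ ω)) - μ ω (A t ω)) =ᵐ[P]
      fun ω => g (history A X t ω, (μ ω, μs t ω)) := by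
    filter_upwards [hTS.pull t ht] with ω hω
    simp only [g, hω]
  have e2 : (fun ω => c * √(postVar v₀ v (history A X t ω) (A t ω) : ℝ) + ∑ i, √(v₀ i : ℝ) * e)
      =ᵐ[P] fun ω => G (history A X t ω, (μ ω, μs t ω)) := by
    filter_upwards [hTS.pull t ht] with ω hω
    simp only [G, hω]
  have ig : Integrable g (P.map fun ω => (history A X t ω, (μ ω, μs t ω))) :=
    (integrable_map_measure hg.aestronglyMeasurable hall).2 ((hTS.integrable_gap hm ht).congr e1)
  have iG : Integrable G (P.map fun ω => (history A X t ω, (μ ω, μs t ω))) :=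
    (integrable_map_measure hG.aestronglyMeasurable hall).2
      ((((hTS.integrable_sqrt_postVar ht).const_mul c).add (integrable_const _)).congr e2)
  rw [integral_congr_ae e1, integral_congr_ae e2, ← integral_map hall hg.aestronglyMeasurable,
    ← integral_map hall hG.aestronglyMeasurable]
  -- Disintegrating over the history reduces the claim to two independent draws from a fixed
  -- posterior.
  rw [hmap] at ig iG ⊢
  rw [Measure.integral_compProd ig, Measure.integral_compProd iG]
  refine integral_mono ig.integral_compProd iG.integral_compProd fun h => ?_
  simp only [Kernel.prod_apply]
  refine (integral_prod_gap_le (postMean m₀ v₀ v h) (postVar v₀ v h) hm hc).trans ?_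
  have hb : Integrable (fun p : (Fin K → ℝ) × (Fin K → ℝ) =>
      c * √(postVar v₀ v h (argmax p.2) : ℝ))
      ((posterior t m₀ v₀ v h).prod (posterior t m₀ v₀ v h)) := by
    refine Integrable.const_mul (Integrable.of_bound (C := ∑ j, √(v₀ j : ℝ))
      (measurable_sqrt_postVar_apply measurable_const (by fun_prop)).aestronglyMeasurable
      (ae_of_all _ fun ω => ?_)) c
    rw [Real.norm_of_nonneg (Real.sqrt_nonneg _)]
    exact sqrt_postVar_le _ _
  -- The widths agree. In the violation term the posterior variances are replaced by the larger
  -- prior variances.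
  refine integral_mono (hb.add (integrable_const _)) (hb.add (integrable_const _)) fun p => ?_
  refine add_le_add le_rfl (Finset.sum_le_sum fun i _ => mul_le_mul_of_nonneg_right
    (Real.sqrt_le_sqrt (NNReal.coe_le_coe.2 (postVar_le v₀ v h i))) he0)

/-- Equality for `δ ≤ 1`. For `δ > 1` the square root is `0` and the left side is `1`. -/
lemma exp_neg_sq_sqrt_two_mul_log_le {δ : ℝ} (hδ : 0 < δ) :
    Real.exp (-√(2 * Real.log (1 / δ)) ^ 2 / 2) ≤ δ := by
  by_cases hl : 0 ≤ Real.log (1 / δ)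
  · rw [Real.sq_sqrt (by positivity), one_div, Real.log_inv]
    rw [show -(2 * -Real.log δ) / 2 = Real.log δ by ring, Real.exp_log hδ]
  · have hl' := not_le.1 hl
    rw [Real.sqrt_eq_zero_of_nonpos (by linarith)]
    rw [one_div, Real.log_inv] at hl'
    simp only [ne_eq, OfNat.ofNat_ne_zero, not_false_eq_true, zero_pow, neg_zero, zero_div,
      Real.exp_zero]
    exact ((Real.log_pos_iff hδ.le).1 (by linarith)).le

/-- The one-sided tail gives the constant `1 / √(2π)`, which is half of `√(2/π)`. -/
lemma sqrt_mul_inv_sqrt_two_pi_mul_le (w : ℝ≥0) {e δ : ℝ} (he : e ≤ δ) (hδ : 0 < δ) :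
    √(w : ℝ) * ((√(2 * Real.pi))⁻¹ * e) ≤ √(2 * (w : ℝ) / Real.pi) * δ := by
  have hpi := Real.pi_pos
  rw [← mul_assoc, ← div_eq_mul_inv, ← Real.sqrt_div (NNReal.coe_nonneg w)]
  have : (w : ℝ) / (2 * Real.pi) ≤ 2 * (w : ℝ) / Real.pi := by
    rw [div_le_div_iff₀ (by positivity) hpi]
    nlinarith [mul_nonneg w.2 hpi.le]
  exact (mul_le_mul_of_nonneg_left he (Real.sqrt_nonneg _)).trans (by gcongr)

/-- Subadditivity of the square root separates the learning cost from the cost of the first pulls.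
For `l < 0` the left side is `0`. -/
lemma sqrt_two_mul_log_mul_sqrt_le {a b l : ℝ} (ha : 0 ≤ a) (hb : 0 ≤ b) (n : ℕ) :
    √(2 * l) * √(n * (a + b)) ≤ √(2 * n) * √(a * l) + √(2 * n * (b * l)) := by
  by_cases hl : 0 ≤ l
  · rw [← Real.sqrt_mul (by positivity), ← Real.sqrt_mul (by positivity),
      show 2 * l * (n * (a + b)) = 2 * n * (a * l) + 2 * n * (b * l) by ring]
    have hx : 0 ≤ 2 * n * (a * l) := by positivity
    have hy : 0 ≤ 2 * n * (b * l) := by positivity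
    refine Real.sqrt_le_iff.2 ⟨by positivity, ?_⟩
    rw [add_sq, Real.sq_sqrt hx, Real.sq_sqrt hy]
    have : 0 ≤ 2 * √(2 * n * (a * l)) * √(2 * n * (b * l)) := by positivity
    linarith
  · rw [Real.sqrt_eq_zero_of_nonpos (by linarith), zero_mul]
    positivity

theorem IsGaussianTS.integral_regret_le (hTS : IsGaussianTS P n m₀ v₀ v argmax μ μs A X)
    (hm : Measurable argmax) {δ : ℝ} (hδ : 0 < δ) :
    ∫ ω, regret n argmax μ A ω ∂P ≤ regretBound n δ v₀ v := by
  set c : ℝ := √(2 * Real.log (1 / δ)) with hc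
  set C : ℝ := ∑ i, √(v₀ i : ℝ) * ((√(2 * Real.pi))⁻¹ * Real.exp (-c ^ 2 / 2)) with hC
  have hc0 : 0 ≤ c := Real.sqrt_nonneg _
  have hi : ∀ t ∈ Finset.range n, Integrable
      (fun ω => c * √(postVar v₀ v (history A X t ω) (A t ω) : ℝ) + C) P := fun t ht =>
    ((hTS.integrable_sqrt_postVar (Finset.mem_range.1 ht)).const_mul c).add (integrable_const _)
  calc ∫ ω, regret n argmax μ A ω ∂P
      = ∑ t ∈ Finset.range n, ∫ ω, (μ ω (argmax (μ ω)) - μ ω (A t ω)) ∂P :=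
        integral_finsetSum _ fun t ht => hTS.integrable_gap hm (Finset.mem_range.1 ht)
    _ ≤ ∑ t ∈ Finset.range n,
        ∫ ω, (c * √(postVar v₀ v (history A X t ω) (A t ω) : ℝ) + C) ∂P :=
        Finset.sum_le_sum fun t ht => hTS.integral_gap_le hm (Finset.mem_range.1 ht) hc0
    _ = ∫ ω, ∑ t ∈ Finset.range n,
        (c * √(postVar v₀ v (history A X t ω) (A t ω) : ℝ) + C) ∂P :=
        (integral_finsetSum _ hi).symm
    _ ≤ ∫ _, (c * √(n * (∑ i, (v i : ℝ) * Real.log (1 + n * (v₀ i : ℝ) / (v i : ℝ))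
          + ∑ i, (v₀ i : ℝ))) + n * C) ∂P := by
        refine integral_mono (integrable_finsetSum _ hi) (integrable_const _) fun ω => ?_
        simp only [Finset.sum_add_distrib, ← Finset.mul_sum, Finset.sum_const, Finset.card_range,
          nsmul_eq_mul]
        gcongr
        exact sum_sqrt_postVar_le v₀ v A X n ω
    _ = c * √(n * (∑ i, (v i : ℝ) * Real.log (1 + n * (v₀ i : ℝ) / (v i : ℝ))
          + ∑ i, (v₀ i : ℝ))) + n * C := by simp
    _ ≤ regretBound n δ v₀ v := by
        unfold regretBound
        simp only [← Finset.sum_mul]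
        refine add_le_add (sqrt_two_mul_log_mul_sqrt_le
          (Finset.sum_nonneg fun i _ => mul_log_nonneg _ _ _)
          (Finset.sum_nonneg fun i _ => (v₀ i).2) n) ?_
        have h : C ≤ (∑ i, √(2 * (v₀ i : ℝ) / Real.pi)) * δ := by
          rw [Finset.sum_mul]
          exact Finset.sum_le_sum fun i _ =>
            sqrt_mul_inv_sqrt_two_pi_mul_le _ (exp_neg_sq_sqrt_two_mul_log_le hδ) hδ
        calc n * C ≤ n * ((∑ i, √(2 * (v₀ i : ℝ) / Real.pi)) * δ) := by gcongr
          _ = _ := by ring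

end

end GaussianBandit

end

open GaussianBandit in
theorem mainTheorem1 {Ω : Type*} [MeasurableSpace Ω] (P : Measure Ω) [IsProbabilityMeasure P]
    (K : ℕ) (n : ℕ) (m₀ : Fin K → ℝ) (v₀ v : Fin K → ℝ≥0)
    (argmax : (Fin K → ℝ) → Fin K) (hargmax : IsArgmaxRule argmax)
    (μ : Ω → Fin K → ℝ) (μs : ℕ → Ω → Fin K → ℝ) (A : ℕ → Ω → Fin K) (X : ℕ → Ω → ℝ)
    (hTS : IsGaussianTS P n m₀ v₀ v argmax μ μs A X)
    (δ : ℝ) (hδ : 0 < δ) :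
    (Integrable (regret n argmax μ A) P ∧
      ∫ ω, regret n argmax μ A ω ∂P ≤ regretBound n δ v₀ v) ∧
    ∀ v₀' v' : Fin K → ℝ≥0, (∀ i, v₀' i ≤ v₀ i) → (∀ i, v' i ≤ v i) →
      regretBound n δ v₀' v' ≤ regretBound n δ v₀ v := by
  exact ⟨⟨hTS.integrable_regret hargmax.measurable, hTS.integral_regret_le hargmax.measurable hδ⟩,
    fun _ _ h₀ h => regretBound_mono hδ h₀ h⟩
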